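/- Let $G(N,p)$ be the Erd\H{o}s--R\'enyi random graph on a vertex set $V$ of size $N$, in which every edge is present independently with probability $p$. For a realization $(V,\mathcal E)$ with degrees $d_i$, let $\pi_i = d_i/(2|\mathcal E|)$, let $(X_n)_{n\ge 0}$ be simple random walk on $(V,\mathcal E)$, let $\tau_j=\inf\{m>0 : X_m=j\}$ and $h_{ij}=\mathbb E_i(\tau_j)\in[0,\infty]$, and let $H^i=\sum_{j\in V}\pi_j h_{ij}$ be the random starting time from $i\in V$. Let $a_0>0$ and $\tilde a_0\ge 10$ be constants. Then there exists a constant $C>0$, depending on $a_0$ and $\tilde a_0$ only, with the following property. Let $\xi=\xi_N$ be a real sequence with $1+a_0\le \xi_N\le \tilde a_0\log\log N$ for all sufficiently large $N$, and let $p=p(N)\in[0,1]$ be a sequence with $p(N)>0$ for all sufficiently large $N$ and $$\frac{(\log N)^{2C\xi_N}}{N\,p(N)}\longrightarrow 0\qquad (N\to\infty).$$ Then, asymptotically almost surely, the realization of $G(N,p(N))$ is connected and $H^i = N(1+o(1))$ for each $i\in V$; that is, for every $\varepsilon>0$, the probability that the realization of $G(N,p(N))$ is connected and satisfies $(1-\varepsilon)N\le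 H^i\le(1+\varepsilon)N$ for all $i\in V$ tends to $1$ as $N\to\infty$. -/

import Mathlib

open MeasureTheory ProbabilityTheory Filter Topology
open scoped ENNReal

namespace RandomWalk

variable {V : Type*} [Fintype V] [MeasurableSpace V] [MeasurableSingletonClass V]

/-- One step of simple random walk on `G` from `i`: a uniformly chosen neighbour of `i`.
At an isolated vertex, where simple random walk is not defined, we let the walk stay put. -/
noncomputable def step (G : SimpleGraph V) (i : V) : Measure V :=
  open Classical in
  if (G.neighborSet i).Nonempty then uniformOn (G.neighborSet i) else Measure.dirac i

instance (G : SimpleGraph V) (i : V) : IsProbabilityMeasure (step G i) := by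
  unfold step
  split_ifs with h
  · exact isProbabilityMeasure_uniformOn (Set.toFinite _) h
  · infer_instance

/-- The transition kernel at time `n`: given the history `X 0, …, X n`, the law of `X (n + 1)` is
a step of simple random walk from `X n`. -/
noncomputable def stepKernel (G : SimpleGraph V) (n : ℕ) :
    Kernel (Finset.Iic n → V) V :=
  Kernel.ofFunOfCountable fun x => step G (x ⟨n, Finset.mem_Iic.2 le_rfl⟩)

instance (G : SimpleGraph V) (n : ℕ) : IsMarkovKernel (stepKernel G n) :=
  ⟨fun x => inferInstanceAs (IsProbabilityMeasure (step G (x ⟨n, Finset.mem_Iic.2 le_rfl⟩)))⟩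

/-- The law, on the space of trajectories, of simple random walk on `G` started at `i`. -/
noncomputable def walkLaw (G : SimpleGraph V) (i : V) : Measure (ℕ → V) :=
  Kernel.trajMeasure (X := fun _ => V) (Measure.dirac i) (stepKernel G)

/-- The first time `m > 0` at which the trajectory `ω` is at `j` (infinite if there is none). -/
noncomputable def firstVisit (j : V) (ω : ℕ → V) : ℝ≥0∞ :=
  ⨅ (m : ℕ) (_ : 0 < m ∧ ω m = j), (m : ℝ≥0∞)

/-- The hitting time `h_{ij}`: the expectation of the first time `m > 0` at `j` of simple random
walk started at `i`. -/
noncomputable def hittingTime (G : SimpleGraph V) (i j : V) : ℝ≥0∞ :=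
  ∫⁻ ω, firstVisit j ω ∂(walkLaw G i)

/-- The stationary distribution `π_i = d_i / (2 |E|)`. -/
noncomputable def stationary (G : SimpleGraph V) (i : V) : ℝ≥0∞ :=
  open Classical in (G.degree i : ℝ≥0∞) / (2 * (G.edgeFinset.card : ℝ≥0∞))

/-- The random starting time `H^i = ∑_j π_j h_{ij}`. -/
noncomputable def startingTime (G : SimpleGraph V) (i : V) : ℝ≥0∞ :=
  ∑ j, stationary G j * hittingTime G i j

end RandomWalk

/-! The argument rests on the random target lemma: by the first step equations `i ↦ H^i` is
harmonic, hence constant on a connected graph, and may be averaged over `i ~ π`. This gives `1 + ∑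
j, π_j m_j`, where `m_j` is the mean hitting time of `j` from stationarity, counted as zero at `j`
itself.

Let `P` be the transition operator, `e_j` the indicator of `j`, and `u` the mean-zero solution of `u
- P u = e_j - π_j`. Then `π_j m_j = u j = 1 - 2 π_j + (P² u) j`. The error `(P² u) j` is the
Dirichlet energy of `P u` divided by `d_j`, so it is nonnegative. A Poincaré inequality with
constant `L` bounds it by `L ‖P e_j - π_j‖² / d_j ≤ L / δ`, with `δ` a lower bound for the degrees;
applying `P` before estimating is what gains the factor `1 / δ` (`IsHitting.diag_bounds`). Summing
over `j` gives `N - 1 ≤ H^i ≤ N - 1 + N L / δ` (`sum_hitting_bounds`), so it is enough that `L`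
stays bounded and `δ → ∞`.

For the random graph, Chernoff bounds and a union bound over all vertex sets show that every cut has
at least half its expected size and every degree is at most `3 p N`, once `p N` exceeds a large
multiple of `log N` (`measure_not_hasTypicalCuts_le`). Cheeger's inequality (`poincare_of_cut`) then
gives `L = 288`, and singleton cuts give `δ = p N / 4`. -/

namespace WeightedGraph

/-! ### Reversible weights: transition operator, Dirichlet form, Poincaré inequality -/

variable {V : Type*} [Fintype V]

/-- The total weight at a vertex. -/
noncomputable def deg (a : V → V → ℝ) (i : V) : ℝ := ∑ j, a i j

/-- The transition operator of the random walk with edge weights `a`. -/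
noncomputable def avg (a : V → V → ℝ) (f : V → ℝ) (i : V) : ℝ := (∑ j, a i j * f j) / deg a i

/-- The Dirichlet form of the weights `a`. -/
noncomputable def energy (a : V → V → ℝ) (f : V → ℝ) : ℝ :=
  (∑ i, ∑ j, a i j * (f i - f j) ^ 2) / 2

variable {a : V → V → ℝ}

lemma deg_mul_avg (hd : ∀ i, 0 < deg a i) (f : V → ℝ) (i : V) :
    deg a i * avg a f i = ∑ j, a i j * f j := by
  unfold avg
  field_simp [(hd i).ne']

lemma avg_sub (f g : V → ℝ) (i : V) : avg a (fun k => f k - g k) i = avg a f i - avg a g i := by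
  simp only [avg, mul_sub, Finset.sum_sub_distrib, sub_div]

lemma avg_const (hd : ∀ i, 0 < deg a i) (c : ℝ) (i : V) : avg a (fun _ => c) i = c := by
  have : 0 < ∑ j, a i j := hd i
  simp only [avg, ← Finset.sum_mul, deg]
  field_simp

lemma avg_const_mul (c : ℝ) (f : V → ℝ) (i : V) :
    avg a (fun k => c * f k) i = c * avg a f i := by
  simp only [avg, mul_left_comm _ c, ← Finset.mul_sum, mul_div_assoc]

lemma avg_sum {ι : Type*} (s : Finset ι) (f : ι → V → ℝ) (i : V) :
    avg a (fun k => ∑ l ∈ s, f l k) i = ∑ l ∈ s, avg a (f l) i := by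
  simp only [avg, Finset.mul_sum]
  rw [Finset.sum_comm, Finset.sum_div]

lemma avg_single [DecidableEq V] (i j : V) :
    avg a (fun k => if k = j then 1 else 0) i = a i j / deg a i := by
  simp [avg]

lemma sum_deg_mul_avg (hs : ∀ i j, a i j = a j i) (hd : ∀ i, 0 < deg a i) (f g : V → ℝ) :
    ∑ i, deg a i * (f i * avg a g i) = ∑ i, deg a i * (avg a f i * g i) := by
  have h1 : ∀ i, deg a i * (f i * avg a g i) = ∑ j, a i j * (f i * g j) := fun i => by
    rw [mul_left_comm, deg_mul_avg hd, Finset.mul_sum]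
    exact Finset.sum_congr rfl fun j _ => by ring
  have h2 : ∀ i, deg a i * (avg a f i * g i) = ∑ j, a i j * (f j * g i) := fun i => by
    rw [← mul_assoc, deg_mul_avg hd, Finset.sum_mul]
    exact Finset.sum_congr rfl fun j _ => by ring
  simp only [h1, h2]
  rw [Finset.sum_comm]
  exact Finset.sum_congr rfl fun i _ => Finset.sum_congr rfl fun j _ => by rw [hs]

lemma sum_deg_mul_avg' (hs : ∀ i j, a i j = a j i) (hd : ∀ i, 0 < deg a i) (f : V → ℝ) :
    ∑ i, deg a i * avg a f i = ∑ i, deg a i * f i := by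
  simpa [avg_const hd] using sum_deg_mul_avg hs hd (fun _ => 1) f

lemma sum_deg_mul_sub_avg (hs : ∀ i j, a i j = a j i) (hd : ∀ i, 0 < deg a i) (f g : V → ℝ) :
    ∑ i, deg a i * (f i * (g i - avg a g i)) =
      (∑ i, ∑ j, a i j * ((f i - f j) * (g i - g j))) / 2 := by
  have h1 : ∀ i, deg a i * (f i * (g i - avg a g i)) = ∑ j, a i j * (f i * (g i - g j)) := by
    intro i
    have : deg a i * (f i * (g i - avg a g i)) =
        f i * (deg a i * g i) - f i * (deg a i * avg a g i) := by ring
    rw [this, deg_mul_avg hd, deg, Finset.sum_mul, Finset.mul_sum, Finset.mul_sum,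
      ← Finset.sum_sub_distrib]
    exact Finset.sum_congr rfl fun j _ => by ring
  have h2 : ∑ i, ∑ j, a i j * (f i * (g i - g j)) = ∑ i, ∑ j, a i j * (f j * (g j - g i)) := by
    rw [Finset.sum_comm]
    exact Finset.sum_congr rfl fun i _ => Finset.sum_congr rfl fun j _ => by rw [hs]
  have h3 : ∑ i, ∑ j, a i j * ((f i - f j) * (g i - g j)) =
      ∑ i, ∑ j, a i j * (f i * (g i - g j)) + ∑ i, ∑ j, a i j * (f j * (g j - g i)) := by
    simp only [← Finset.sum_add_distrib]
    exact Finset.sum_congr rfl fun i _ => Finset.sum_congr rfl fun j _ => by ring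
  rw [h3, ← h2]
  simp only [h1]
  ring

lemma energy_eq (hs : ∀ i j, a i j = a j i) (hd : ∀ i, 0 < deg a i) (f : V → ℝ) :
    energy a f = ∑ i, deg a i * (f i * (f i - avg a f i)) := by
  rw [sum_deg_mul_sub_avg hs hd, energy]
  simp only [sq]

lemma energy_sub_const (f : V → ℝ) (c : ℝ) : energy a (fun i => f i - c) = energy a f := by
  simp [energy]

/-- The Poincaré inequality with constant `L`. -/
def Poincare (a : V → V → ℝ) (L : ℝ) : Prop :=
  ∀ f : V → ℝ, ∑ i, deg a i * f i = 0 → ∑ i, deg a i * f i ^ 2 ≤ L * energy a f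

/-- Apply the Poincaré inequality to `f` minus its weighted mean. This plays the role of
connectedness: harmonic functions are constant. -/
lemma Poincare.eq_of_energy_eq_zero {L : ℝ} (hP : Poincare a L) (hd : ∀ i, 0 < deg a i)
    {f : V → ℝ} (hf : energy a f = 0) (i j : V) : f i = f j := by
  set M := ∑ i, deg a i with hM
  have hM0 : 0 < M := Finset.sum_pos (fun i _ => hd i) ⟨i, Finset.mem_univ i⟩
  set c := (∑ i, deg a i * f i) / M with hc
  have h0 : ∑ i, deg a i * (f i - c) = 0 := by
    simp only [mul_sub, Finset.sum_sub_distrib, ← Finset.sum_mul]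
    rw [← hM, hc]
    field_simp
    ring
  have h1 := hP (fun i => f i - c) h0
  rw [energy_sub_const, hf, mul_zero] at h1
  have h2 : ∀ k, f k = c := by
    intro k
    have := (Finset.sum_eq_zero_iff_of_nonneg
      (fun k _ => mul_nonneg (hd k).le (sq_nonneg (f k - c)))).1
      (le_antisymm h1 (Finset.sum_nonneg fun k _ => mul_nonneg (hd k).le (sq_nonneg (f k - c))))
      k (Finset.mem_univ k)
    have h3 : (f k - c) ^ 2 = 0 := (mul_eq_zero.1 this).resolve_left (hd k).ne'
    linarith [pow_eq_zero_iff (two_ne_zero) |>.1 h3]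
  rw [h2, h2]

/-- In the `deg`-weighted inner product `⟨v, w⟩` is the energy of `w`, so Poincaré gives `‖w‖² ≤ L
⟨v, w⟩`. Insert this into `2 L ⟨v, w⟩ ≤ L² ‖v‖² + ‖w‖²`. -/
lemma inner_le_of_sub_avg_eq {L : ℝ} (hs : ∀ i j, a i j = a j i) (hd : ∀ i, 0 < deg a i)
    (hP : Poincare a L) (hL : 0 < L) {v w : V → ℝ}
    (hw : ∑ i, deg a i * w i = 0) (hv : ∀ i, w i - avg a w i = v i) :
    ∑ i, deg a i * (v i * w i) ≤ L * ∑ i, deg a i * v i ^ 2 := by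
  have h1 : energy a w = ∑ i, deg a i * (v i * w i) := by
    rw [energy_eq hs hd]
    exact Finset.sum_congr rfl fun i _ => by rw [hv]; ring
  have h2 := hP w hw
  rw [h1] at h2
  have h3 : 2 * L * ∑ i, deg a i * (v i * w i) ≤
      L ^ 2 * ∑ i, deg a i * v i ^ 2 + ∑ i, deg a i * w i ^ 2 := by
    rw [Finset.mul_sum, Finset.mul_sum, ← Finset.sum_add_distrib]
    refine Finset.sum_le_sum fun i _ => ?_
    nlinarith [mul_nonneg (hd i).le (sq_nonneg (L * v i - w i))]
  have h4 : L * ∑ i, deg a i * (v i * w i) ≤ L * (L * ∑ i, deg a i * v i ^ 2) := by nlinarith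
  exact le_of_mul_le_mul_left h4 hL

lemma inner_nonneg_of_sub_avg_eq (hs : ∀ i j, a i j = a j i) (h0 : ∀ i j, 0 ≤ a i j)
    (hd : ∀ i, 0 < deg a i) {v w : V → ℝ} (hv : ∀ i, w i - avg a w i = v i) :
    0 ≤ ∑ i, deg a i * (v i * w i) := by
  have h1 : energy a w = ∑ i, deg a i * (v i * w i) := by
    rw [energy_eq hs hd]
    exact Finset.sum_congr rfl fun i _ => by rw [hv]; ring
  rw [← h1]
  exact div_nonneg (Finset.sum_nonneg fun i _ => Finset.sum_nonneg fun j _ =>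
    mul_nonneg (h0 i j) (sq_nonneg _)) zero_le_two

/-! ### Hitting times and the random target lemma -/

section Hitting

variable [DecidableEq V]

/-- `f` is the solution of the first step equations for the hitting time of `j`. -/
def IsHitting (a : V → V → ℝ) (j : V) (f : V → ℝ) : Prop :=
  ∀ i, f i = 1 + avg a (fun k => if k = j then 0 else f k) i

/-- Kac's formula. -/
lemma IsHitting.deg_mul_self (hs : ∀ i j, a i j = a j i) (hd : ∀ i, 0 < deg a i) {j : V}
    {f : V → ℝ} (hf : IsHitting a j f) : deg a j * f j = ∑ i, deg a i := by
  have h1 : ∑ i, deg a i * f i = ∑ i, deg a i + ∑ i, deg a i * (if i = j then 0 else f i) := by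
    rw [← sum_deg_mul_avg' hs hd (fun i => if i = j then 0 else f i), ← Finset.sum_add_distrib]
    exact Finset.sum_congr rfl fun i _ => by
      conv_lhs => rw [hf i]
      ring
  have h2 : ∑ i, deg a i * f i =
      deg a j * f j + ∑ i, deg a i * (if i = j then 0 else f i) := by
    rw [← Finset.add_sum_erase _ _ (Finset.mem_univ j),
      ← Finset.add_sum_erase Finset.univ (fun i => deg a i * (if i = j then 0 else f i))
        (Finset.mem_univ j)]
    simp only [if_true, mul_zero, zero_add]
    congr 1
    exact Finset.sum_congr rfl fun i hi => by rw [if_neg (Finset.ne_of_mem_erase hi)]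
  linarith

/-- The middle quantity is `π_j m_j`. It is computed exactly up to a term that is a Dirichlet
energy, which the Poincaré inequality controls. -/
lemma IsHitting.diag_bounds {L δ : ℝ} (hs : ∀ i j, a i j = a j i) (h0 : ∀ i j, 0 ≤ a i j)
    (h1 : ∀ i j, a i j ≤ 1) (hl : ∀ i, a i i = 0) (hδ : 0 < δ) (hdδ : ∀ i, δ ≤ deg a i)
    (hP : Poincare a L) (hL : 0 < L) {j : V} {f : V → ℝ} (hf : IsHitting a j f)
    {M : ℝ} (hM : M = ∑ i, deg a i) :
    1 - 2 * (deg a j / M) ≤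
      deg a j / M * ∑ i, deg a i / M * (if i = j then 0 else f i) ∧
    deg a j / M * ∑ i, deg a i / M * (if i = j then 0 else f i) ≤
      1 - 2 * (deg a j / M) + L / δ := by
  have hd : ∀ i, 0 < deg a i := fun i => hδ.trans_le (hdδ i)
  have hM0 : 0 < M := hM ▸ Finset.sum_pos (fun i _ => hd i) ⟨j, Finset.mem_univ j⟩
  set g : V → ℝ := fun k => if k = j then 0 else f k with hg
  set m : ℝ := ∑ i, deg a i / M * g i with hm
  set r : ℝ := deg a j / M with hr
  have hrf : r * f j = 1 := by
    rw [hr, div_mul_eq_mul_div, hf.deg_mul_self hs hd, ← hM, div_self hM0.ne']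
  have hmM : M * m = ∑ i, deg a i * g i := by
    rw [hm, Finset.mul_sum]
    exact Finset.sum_congr rfl fun i _ => by field_simp
  -- The mean-zero solution of `u - P u = e - r`. At `j` the equation holds by Kac's formula `r * f
  -- j = 1`.
  set u : V → ℝ := fun k => r * m - r * g k with hu
  set e : V → ℝ := fun k => if k = j then 1 else 0 with he
  have havu : ∀ i, avg a u i = r * m - r * avg a g i := fun i => by
    rw [hu, avg_sub, avg_const hd, avg_const_mul]
  have huP : ∀ i, avg a u i = u i - e i + r := by
    intro i
    have h2 : avg a g i = f i - 1 := by rw [hf i]; ring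
    rw [havu, h2]
    by_cases hij : i = j
    · subst hij
      simp only [hu, hg, he, if_true]
      linarith
    · simp only [hu, hg, he, if_neg hij]
      ring
  have hsumu : ∑ i, deg a i * u i = 0 := by
    have h2 : ∀ i, deg a i * u i = r * m * deg a i - r * (deg a i * g i) := fun i => by
      simp only [hu]; ring
    simp only [h2, Finset.sum_sub_distrib, ← Finset.mul_sum]
    rw [← hM, ← hmM]
    ring
  -- Smoothing once replaces the source `e - r` by `P e - r`, whose squared norm is smaller by a
  -- factor `δ`.
  set w : V → ℝ := fun k => avg a u k with hw
  have hsumw : ∑ i, deg a i * w i = 0 := by rw [hw, sum_deg_mul_avg' hs hd, hsumu]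
  set v : V → ℝ := fun k => avg a e k - r with hv
  have havw : ∀ i, w i - avg a w i = v i := by
    intro i
    have h2 : avg a w i = avg a u i - avg a e i + r := by
      have h3 : w = fun k => u k - (e k - r) := by
        funext k
        rw [hw]
        simp only [huP]
        ring
      rw [h3, avg_sub u fun k => e k - r, avg_sub e, avg_const hd]
      ring
    rw [h2]
    simp only [hw, hv]
    ring
  have hinner : ∑ i, deg a i * (v i * w i) = deg a j * avg a w j := by
    have h2 : ∀ i, deg a i * (v i * w i) = deg a i * (avg a e i * w i) - r * (deg a i * w i) :=
      fun i => by simp only [hv]; ring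
    simp only [h2, Finset.sum_sub_distrib, ← Finset.mul_sum]
    rw [hsumw, ← sum_deg_mul_avg hs hd]
    simp [he]
  have hvv : ∑ i, deg a i * v i ^ 2 ≤ deg a j / δ := by
    have h2 : ∀ i, deg a i * v i ^ 2 =
        deg a i * avg a e i ^ 2 - 2 * r * (deg a i * avg a e i) + r ^ 2 * deg a i :=
      fun i => by simp only [hv]; ring
    have h3 : ∑ i, deg a i * v i ^ 2 =
        ∑ i, deg a i * avg a e i ^ 2 - r * deg a j := by
      simp only [h2, Finset.sum_add_distrib, Finset.sum_sub_distrib, ← Finset.mul_sum]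
      rw [sum_deg_mul_avg' hs hd, ← hM]
      have : ∑ i, deg a i * e i = deg a j := by simp [he]
      rw [this]
      have : r * M = deg a j := by rw [hr]; field_simp
      rw [sq r, mul_assoc r r, this]
      ring
    have h4 : 0 ≤ r * deg a j := mul_nonneg (div_nonneg (hd j).le hM0.le) (hd j).le
    -- Each term is `a i j ^ 2 / deg a i`; use `a i j ≤ 1` and `δ ≤ deg a i`.
    have h5 : ∑ i, deg a i * avg a e i ^ 2 ≤ ∑ i, a i j / δ := by
      refine Finset.sum_le_sum fun i _ => ?_
      rw [he, avg_single]
      have : deg a i * (a i j / deg a i) ^ 2 = a i j * a i j / deg a i := by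
        have := (hd i).ne'
        field_simp
      rw [this]
      gcongr
      · exact h0 i j
      · exact mul_le_of_le_one_right (h0 i j) (h1 i j)
      · exact hdδ i
    have h6 : ∑ i, a i j / δ = deg a j / δ := by
      rw [← Finset.sum_div, deg]
      congr 1
      exact Finset.sum_congr rfl fun i _ => hs i j
    linarith
  have hlow : 0 ≤ deg a j * avg a w j := by
    rw [← hinner]
    exact inner_nonneg_of_sub_avg_eq hs h0 hd havw
  have hup : deg a j * avg a w j ≤ L * (deg a j / δ) := by
    rw [← hinner]
    exact (inner_le_of_sub_avg_eq hs hd hP hL hsumw havw).trans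
      (mul_le_mul_of_nonneg_left hvv hL.le)
  have hlow' : 0 ≤ avg a w j := nonneg_of_mul_nonneg_right hlow (hd j)
  have hup' : avg a w j ≤ L / δ := by
    have : L * (deg a j / δ) = deg a j * (L / δ) := by ring
    rw [this] at hup
    exact le_of_mul_le_mul_left hup (hd j)
  -- Evaluate both equations at `j`. Absence of loops makes `avg a e j` vanish, which produces the
  -- second `-r`.
  have hfin : r * m = 1 - 2 * r + avg a w j := by
    have h2 := huP j
    have h3 := havw j
    have h4 : avg a e j = 0 := by rw [he, avg_single, hl]; simp
    have h5 : u j = r * m := by simp [hu, hg]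
    have h6 : e j = 1 := by simp [he]
    have h7 : v j = -r := by simp [hv, h4]
    have h8 : w j = avg a u j := rfl
    linarith
  rw [hfin]
  constructor <;> linarith

/-- The random starting time is, up to `L / δ` per vertex, the number of vertices. -/
theorem sum_hitting_bounds {L δ : ℝ} (hs : ∀ i j, a i j = a j i) (h0 : ∀ i j, 0 ≤ a i j)
    (h1 : ∀ i j, a i j ≤ 1) (hl : ∀ i, a i i = 0) (hδ : 0 < δ) (hdδ : ∀ i, δ ≤ deg a i)
    (hP : Poincare a L) (hL : 0 < L) {h : V → V → ℝ} (hh : ∀ j, IsHitting a j (h · j))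
    {M : ℝ} (hM : M = ∑ i, deg a i) (i : V) :
    (Fintype.card V : ℝ) - 1 ≤ ∑ j, deg a j / M * h i j ∧
      ∑ j, deg a j / M * h i j ≤ Fintype.card V - 1 + Fintype.card V * (L / δ) := by
  have hd : ∀ i, 0 < deg a i := fun i => hδ.trans_le (hdδ i)
  have hM0 : 0 < M := hM ▸ Finset.sum_pos (fun i _ => hd i) ⟨i, Finset.mem_univ i⟩
  set g : V → V → ℝ := fun j k => if k = j then 0 else h k j with hg
  set K : V → ℝ := fun k => ∑ j, deg a j / M * g j k with hK
  have hkac : ∀ j, deg a j / M * h j j = 1 := fun j => by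
    rw [div_mul_eq_mul_div, (hh j).deg_mul_self hs hd, ← hM, div_self hM0.ne']
  have hone : ∑ j, deg a j / M = 1 := by rw [← Finset.sum_div, ← hM, div_self hM0.ne']
  have hHK : ∀ k, ∑ j, deg a j / M * h k j = 1 + K k := by
    intro k
    rw [hK]
    simp only
    rw [← Finset.add_sum_erase _ _ (Finset.mem_univ k), hkac,
      ← Finset.add_sum_erase Finset.univ (fun j => deg a j / M * g j k) (Finset.mem_univ k)]
    simp only [hg, if_true, mul_zero, zero_add]
    congr 1
    exact Finset.sum_congr rfl fun j hj => by rw [if_neg (Finset.ne_of_mem_erase hj).symm]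
  -- Averaging lowers each term by its weight, in total by `1`; the diagonal term, equal to `1` by
  -- Kac's formula, makes up for it.
  have hharm : ∀ k, avg a K k = K k := by
    intro k
    have h2 : ∀ j, avg a (g j) k = h k j - 1 := fun j => by
      have := hh j k
      simp only at this
      rw [this]
      simp [hg]
    rw [hK, avg_sum]
    simp only [avg_const_mul, h2, mul_sub, mul_one, Finset.sum_sub_distrib, hone]
    rw [hHK]
    ring
  have henergy : energy a K = 0 := by
    rw [energy_eq hs hd]
    simp [hharm]
  have hconst : ∀ k, K k = K i := fun k => hP.eq_of_energy_eq_zero hd henergy k i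
  have hKi : K i = ∑ j, deg a j / M * ∑ k, deg a k / M * g j k := by
    calc K i = ∑ k, deg a k / M * K k := by
          simp only [hconst, ← Finset.sum_mul, hone, one_mul]
      _ = _ := by
          simp only [hK, Finset.mul_sum]
          rw [Finset.sum_comm]
          exact Finset.sum_congr rfl fun j _ => Finset.sum_congr rfl fun k _ => by ring
  have hb := fun j => (hh j).diag_bounds hs h0 h1 hl hδ hdδ hP hL hM
  have hlow : ∑ j, (1 - 2 * (deg a j / M)) ≤ K i := by
    rw [hKi]
    exact Finset.sum_le_sum fun j _ => (hb j).1
  have hup : K i ≤ ∑ j, (1 - 2 * (deg a j / M) + L / δ) := by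
    rw [hKi]
    exact Finset.sum_le_sum fun j _ => (hb j).2
  simp only [Finset.sum_add_distrib, Finset.sum_sub_distrib, ← Finset.mul_sum, hone,
    Finset.sum_const, Finset.card_univ, nsmul_eq_mul, mul_one] at hlow hup
  rw [hHK]
  constructor <;> linarith

/-- The first step equations form a square linear system, so uniqueness yields existence.
Nonnegativity comes from testing against the negative part. -/
lemma exists_isHitting {L : ℝ} (hs : ∀ i j, a i j = a j i) (h0 : ∀ i j, 0 ≤ a i j)
    (hd : ∀ i, 0 < deg a i) (hP : Poincare a L) (j : V) :
    ∃ f : V → ℝ, IsHitting a j f ∧ ∀ i, 0 ≤ f i := by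
  set T : (V → ℝ) →ₗ[ℝ] (V → ℝ) :=
    { toFun := fun f i => f i - avg a (fun k => if k = j then 0 else f k) i
      map_add' := fun f g => by
        funext i
        have : (fun k => if k = j then 0 else (f + g) k) =
            fun k => (if k = j then 0 else f k) - (-1) * (if k = j then 0 else g k) := by
          funext k
          split_ifs <;> simp
        rw [this, avg_sub, avg_const_mul]
        simp only [Pi.add_apply]
        ring
      map_smul' := fun c f => by
        funext i
        have : (fun k => if k = j then 0 else (c • f) k) =
            fun k => c * (if k = j then 0 else f k) := by
          funext k
          split_ifs <;> simp
        rw [this, avg_const_mul]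
        simp only [Pi.smul_apply, smul_eq_mul, RingHom.id_apply]
        ring } with hT
  have hTa : ∀ f i, T f i = f i - avg a (fun k => if k = j then 0 else f k) i := fun f i => rfl
  have hinj : Function.Injective T := by
    rw [injective_iff_map_eq_zero]
    intro f hf
    set g : V → ℝ := fun k => if k = j then 0 else f k with hg
    have hfg : ∀ i, f i = avg a g i := fun i => by
      have := congrFun hf i
      rw [hTa] at this
      simpa [sub_eq_zero] using this
    -- For a homogeneous solution `g` is harmonic off `j` and zero at `j`, so every term of `⟨g, g -
    -- P g⟩` vanishes.
    have he : energy a g = 0 := by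
      rw [energy_eq hs hd]
      refine Finset.sum_eq_zero fun i _ => ?_
      by_cases hij : i = j
      · simp [hg, hij]
      · rw [← hfg]
        simp [hg, hij]
    have hgz : ∀ i, g i = 0 := fun i => by
      rw [hP.eq_of_energy_eq_zero hd he i j]
      simp [hg]
    funext i
    rw [hfg, show g = fun _ => 0 from funext hgz, avg_const hd]
    rfl
  obtain ⟨f, hf⟩ := LinearMap.injective_iff_surjective.1 hinj (fun _ => 1)
  have hfe : IsHitting a j f := fun i => by
    have := congrFun hf i
    rw [hTa] at this
    linarith
  refine ⟨f, hfe, ?_⟩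
  set g : V → ℝ := fun k => if k = j then 0 else f k with hg
  set n : V → ℝ := fun k => max (-g k) 0 with hn
  have hn0 : ∀ k, 0 ≤ n k := fun k => le_max_right _ _
  have h1 : ∑ i, deg a i * (n i * (g i - avg a g i)) = ∑ i, deg a i * n i := by
    refine Finset.sum_congr rfl fun i _ => ?_
    by_cases hij : i = j
    · simp [hn, hg, hij]
    · have : g i - avg a g i = 1 := by
        have h2 := hfe i
        rw [show g i = f i by simp [hg, hij], h2]
        simp [hg]
      rw [this, mul_one]
  -- The negative part decreases in `g`, so its mixed Dirichlet form with `g` is nonpositive; by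
  -- `h1` that form is the sum of `deg * n`.
  have h2 : ∑ i, deg a i * (n i * (g i - avg a g i)) ≤ 0 := by
    rw [sum_deg_mul_sub_avg hs hd]
    refine div_nonpos_of_nonpos_of_nonneg ?_ zero_le_two
    refine Finset.sum_nonpos fun i _ => Finset.sum_nonpos fun k _ =>
      mul_nonpos_of_nonneg_of_nonpos (h0 i k) ?_
    rcases le_total (g i) (g k) with h | h
    · exact mul_nonpos_of_nonneg_of_nonpos
        (sub_nonneg.2 (max_le_max_right 0 (neg_le_neg h))) (sub_nonpos.2 h)
    · exact mul_nonpos_of_nonpos_of_nonneg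
        (sub_nonpos.2 (max_le_max_right 0 (neg_le_neg h))) (sub_nonneg.2 h)
  have h3 : ∀ i, n i = 0 := fun i => by
    have := (Finset.sum_eq_zero_iff_of_nonneg
      (fun k _ => mul_nonneg (hd k).le (hn0 k))).1
      (le_antisymm (h1 ▸ h2) (Finset.sum_nonneg fun k _ => mul_nonneg (hd k).le (hn0 k)))
      i (Finset.mem_univ i)
    exact (mul_eq_zero.1 this).resolve_left (hd i).ne'
  have hg0 : ∀ i, 0 ≤ g i := fun i => by
    have : -g i ≤ n i := le_max_left _ _
    linarith [h3 i]
  intro i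
  rw [hfe i]
  exact add_nonneg zero_le_one
    (div_nonneg (Finset.sum_nonneg fun k _ => mul_nonneg (h0 i k) (hg0 k)) (hd i).le)

end Hitting

end WeightedGraph

/-! ### Cheeger's inequality from cut bounds -/

namespace WeightedGraph

variable {V : Type*} [Fintype V] {a : V → V → ℝ}

lemma integral_indicator_Ico (x y : ℝ) :
    ∫ t, (Set.Ico x y).indicator (fun _ => (1 : ℝ)) t = max (y - x) 0 := by
  rw [integral_indicator measurableSet_Ico, setIntegral_const, Measure.real, Real.volume_Ico,
    smul_eq_mul, mul_one, ENNReal.toReal_ofReal']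

lemma integrable_indicator_Ico (x y : ℝ) :
    Integrable ((Set.Ico x y).indicator fun _ => (1 : ℝ)) :=
  (integrable_indicator_iff measurableSet_Ico).2 (integrableOn_const (by simp))

variable [DecidableEq V] in
/-- The coarea formula: nonnegative cuts give nonnegative weighted total variation. -/
lemma sum_mul_max_sub_nonneg {b : V → V → ℝ}
    (hb : ∀ S : Finset V, 0 ≤ ∑ i ∈ S, ∑ j ∈ Sᶜ, b i j) (g : V → ℝ) :
    0 ≤ ∑ i, ∑ j, b i j * max (g j - g i) 0 := by
  have h1 : ∑ i, ∑ j, b i j * max (g j - g i) 0 =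
      ∫ t, ∑ i, ∑ j, b i j * (Set.Ico (g i) (g j)).indicator (fun _ => (1 : ℝ)) t := by
    rw [integral_finsetSum _ fun i _ => integrable_finsetSum _ fun j _ =>
      (integrable_indicator_Ico _ _).const_mul _]
    refine Finset.sum_congr rfl fun i _ => ?_
    rw [integral_finsetSum _ fun j _ => (integrable_indicator_Ico _ _).const_mul _]
    refine Finset.sum_congr rfl fun j _ => ?_
    rw [integral_const_mul, integral_indicator_Ico]
  rw [h1]
  refine integral_nonneg fun t => ?_
  -- At level `t` the integrand is exactly the cut of the sublevel set.
  have h2 := hb (Finset.univ.filter fun i => g i ≤ t)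
  rw [Finset.sum_filter] at h2
  refine h2.trans_eq (Finset.sum_congr rfl fun i _ => ?_)
  split_ifs with hi
  · rw [Finset.compl_filter, Finset.sum_filter]
    refine Finset.sum_congr rfl fun j _ => ?_
    by_cases hj : g j ≤ t
    · simp [hj]
    · simp [hi, hj, lt_of_not_ge hj]
  · exact (Finset.sum_eq_zero fun j _ => by simp [hi]).symm

variable [DecidableEq V] in
lemma sum_mul_abs_sub_nonneg {b : V → V → ℝ}
    (hb : ∀ S : Finset V, 0 ≤ ∑ i ∈ S, ∑ j ∈ Sᶜ, b i j) (g : V → ℝ) :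
    0 ≤ ∑ i, ∑ j, b i j * |g i - g j| := by
  refine (add_nonneg (sum_mul_max_sub_nonneg hb g)
    (sum_mul_max_sub_nonneg hb fun i => -g i)).trans_eq ?_
  simp only [← Finset.sum_add_distrib, ← mul_add]
  refine Finset.sum_congr rfl fun i _ => Finset.sum_congr rfl fun j _ => ?_
  congr 1
  rcases le_total (g i) (g j) with h | h
  · rw [max_eq_left (by linarith), max_eq_right (by linarith), abs_of_nonpos (by linarith)]
    ring
  · rw [max_eq_right (by linarith), max_eq_left (by linarith), abs_of_nonneg (by linarith)]
    ring

/-- The square of `x` with the sign of `x`. -/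
noncomputable def signedSq (x : ℝ) : ℝ := x * |x|

lemma abs_signedSq_sub_le (x y : ℝ) : |signedSq x - signedSq y| ≤ |x - y| * (|x| + |y|) := by
  unfold signedSq
  rcases le_total 0 x with hx | hx <;> rcases le_total 0 y with hy | hy <;>
    rcases le_total x y with hxy | hxy <;>
    simp only [abs_of_nonneg, abs_of_nonpos, hx, hy, sub_nonneg, sub_nonpos, hxy] <;>
    rw [abs_le] <;> constructor <;> nlinarith

/-- Intermediate value theorem in `m`. This centring lets the differences of `signedSq` control the
full sum of squares. -/
lemma exists_sum_sub_mul_abs_eq_zero [Nonempty V] (f : V → ℝ) :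
    ∃ m, ∑ i, signedSq (f i - m) = 0 := by
  have hc : Continuous fun m => ∑ i, signedSq (f i - m) := by
    unfold signedSq
    fun_prop
  obtain ⟨i, hi⟩ := Finite.exists_max f
  obtain ⟨k, hk⟩ := Finite.exists_min f
  refine mem_range_of_exists_le_of_exists_ge hc ⟨f i, ?_⟩ ⟨f k, ?_⟩
  · exact Finset.sum_nonpos fun l _ =>
      mul_nonpos_of_nonpos_of_nonneg (sub_nonpos.2 (hi l)) (abs_nonneg _)
  · exact Finset.sum_nonneg fun l _ => mul_nonneg (sub_nonneg.2 (hk l)) (abs_nonneg _)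

variable [DecidableEq V] in
-- Apply the coarea inequality to `signedSq` of the centred function: the cut bound compares `a`
-- with the constant weight `c`, and a weighted AM-GM inequality passes from total variation to
-- energy.
lemma sum_sq_le_energy [Nonempty V] (hs : ∀ i j, a i j = a j i) (h0 : ∀ i j, 0 ≤ a i j)
    {c D : ℝ} (hc : 0 < c) (hD0 : 0 < D) (hD : ∀ i, deg a i ≤ D)
    (hcut : ∀ S : Finset V, c * (S.card * (Sᶜ).card) ≤ ∑ i ∈ S, ∑ j ∈ Sᶜ, a i j) (f : V → ℝ) :
    ∃ m, ∑ i, (f i - m) ^ 2 ≤ 8 * D / (c * Fintype.card V) ^ 2 * energy a f := by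
  obtain ⟨m, hm⟩ := exists_sum_sub_mul_abs_eq_zero f
  refine ⟨m, ?_⟩
  rw [← energy_sub_const f m]
  set h : V → ℝ := fun i => f i - m with hh
  change ∑ i, h i ^ 2 ≤ _
  change ∑ i, signedSq (h i) = 0 at hm
  have hN : 0 < (Fintype.card V : ℝ) := by exact_mod_cast Fintype.card_pos
  set Y := ∑ i, h i ^ 2 with hY
  have hcoarea : c * ∑ i, ∑ j, |signedSq (h i) - signedSq (h j)| ≤
      ∑ i, ∑ j, a i j * |signedSq (h i) - signedSq (h j)| := by
    have := sum_mul_abs_sub_nonneg (b := fun i j => a i j - c)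
      (fun S => by
        simp only [Finset.sum_sub_distrib, Finset.sum_const, nsmul_eq_mul, sub_nonneg]
        exact (hcut S).trans' (le_of_eq (by ring))) fun i => signedSq (h i)
    simp only [sub_mul, Finset.sum_sub_distrib, ← Finset.mul_sum, sub_nonneg] at this
    exact this
  have hlow : Fintype.card V * Y ≤ ∑ i, ∑ j, |signedSq (h i) - signedSq (h j)| := by
    rw [hY, Finset.mul_sum]
    refine Finset.sum_le_sum fun i _ => ?_
    refine le_trans (le_of_eq ?_) (Finset.abs_sum_le_sum_abs _ _)
    rw [Finset.sum_sub_distrib, hm, sub_zero, Finset.sum_const, nsmul_eq_mul, Finset.card_univ,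
      signedSq, abs_mul, abs_mul, abs_abs, abs_mul_abs_self, abs_of_nonneg hN.le, sq]
  -- Chosen so that the term `2 * θ * D * Y` absorbs exactly half of the left side.
  set θ := c * Fintype.card V / (4 * D) with hθ
  have hθ0 : 0 < θ := by positivity
  have hup : ∑ i, ∑ j, a i j * |signedSq (h i) - signedSq (h j)| ≤
      energy a h / θ + 2 * θ * D * Y := by
    have h1 : ∀ i j, a i j * |signedSq (h i) - signedSq (h j)| ≤
        a i j * (h i - h j) ^ 2 / (2 * θ) + θ * (a i j * h i ^ 2 + a j i * h j ^ 2) := by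
      intro i j
      have h2 : |h i - h j| * (|h i| + |h j|) ≤
          (h i - h j) ^ 2 / (2 * θ) + θ * (h i ^ 2 + h j ^ 2) := by
        rw [← sq_abs (h i - h j), ← sq_abs (h i), ← sq_abs (h j)]
        generalize |h i - h j| = x
        generalize |h i| = y
        generalize |h j| = z
        have h3 : 0 ≤ (x - θ * (y + z)) ^ 2 / (2 * θ) := by positivity
        have h4 : (x - θ * (y + z)) ^ 2 / (2 * θ) =
            x ^ 2 / (2 * θ) + θ * (y + z) ^ 2 / 2 - x * (y + z) := by
          field_simp
          ring
        have h5 : 0 ≤ θ * (y - z) ^ 2 := by positivity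
        nlinarith
      calc _ ≤ a i j * ((h i - h j) ^ 2 / (2 * θ) + θ * (h i ^ 2 + h j ^ 2)) :=
            mul_le_mul_of_nonneg_left ((abs_signedSq_sub_le _ _).trans h2) (h0 i j)
        _ = _ := by rw [hs j i]; ring
    have h2 : ∑ i, ∑ j, a i j * h i ^ 2 ≤ D * Y := by
      rw [hY, Finset.mul_sum]
      refine Finset.sum_le_sum fun i _ => ?_
      rw [← Finset.sum_mul]
      exact mul_le_mul_of_nonneg_right (hD i) (sq_nonneg _)
    calc _ ≤ ∑ i, ∑ j, (a i j * (h i - h j) ^ 2 / (2 * θ) +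
          θ * (a i j * h i ^ 2 + a j i * h j ^ 2)) :=
          Finset.sum_le_sum fun i _ => Finset.sum_le_sum fun j _ => h1 i j
      _ = energy a h / θ + θ * (∑ i, ∑ j, a i j * h i ^ 2 + ∑ i, ∑ j, a i j * h i ^ 2) := by
          simp only [Finset.sum_add_distrib, ← Finset.sum_div, ← Finset.mul_sum]
          rw [Finset.sum_comm (f := fun i j => a j i * h j ^ 2), energy]
          field_simp
      _ ≤ energy a h / θ + θ * (D * Y + D * Y) := by gcongr
      _ = _ := by ring
  have h1 : c * (Fintype.card V * Y) ≤ energy a h / θ + 2 * θ * D * Y :=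
    (mul_le_mul_of_nonneg_left hlow hc.le).trans (hcoarea.trans hup)
  have h2 : 2 * θ * D * Y = c * (Fintype.card V * Y) / 2 := by
    rw [hθ]
    field_simp
    norm_num
  have h3 : energy a h / θ = 4 * D * energy a h / (c * Fintype.card V) := by
    rw [hθ]
    field_simp
  have h4 : c * (Fintype.card V * Y) ≤ 8 * D * energy a h / (c * Fintype.card V) := by
    have : 8 * D * energy a h / (c * Fintype.card V) =
      2 * (4 * D * energy a h / (c * Fintype.card V)) := by ring
    rw [this]
    linarith
  rw [le_div_iff₀ (by positivity)] at h4
  rw [div_mul_eq_mul_div, le_div_iff₀ (by positivity)]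
  calc _ = _ := by ring
    _ ≤ _ := h4

variable [DecidableEq V] in
/-- Cheeger's inequality. -/
theorem poincare_of_cut (hs : ∀ i j, a i j = a j i) (h0 : ∀ i j, 0 ≤ a i j)
    {c D : ℝ} (hc : 0 < c) (hD0 : 0 < D) (hD : ∀ i, deg a i ≤ D)
    (hcut : ∀ S : Finset V, c * (S.card * (Sᶜ).card) ≤ ∑ i ∈ S, ∑ j ∈ Sᶜ, a i j) :
    Poincare a (8 * (D / (c * Fintype.card V)) ^ 2) := by
  intro f hf
  rcases isEmpty_or_nonempty V with hV | hV
  · simp [energy]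
  obtain ⟨m, hm⟩ := sum_sq_le_energy hs h0 hc hD0 hD hcut f
  -- The weighted mean, here zero, minimizes the weighted square deviation.
  have h1 : ∑ i, deg a i * f i ^ 2 ≤ ∑ i, deg a i * (f i - m) ^ 2 := by
    have h2 : ∀ i, deg a i * (f i - m) ^ 2 =
        deg a i * f i ^ 2 - 2 * m * (deg a i * f i) + deg a i * m ^ 2 := fun i => by ring
    simp only [h2, Finset.sum_add_distrib, Finset.sum_sub_distrib, ← Finset.mul_sum, hf]
    have : 0 ≤ ∑ i, deg a i * m ^ 2 := Finset.sum_nonneg fun i _ =>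
      mul_nonneg (Finset.sum_nonneg fun j _ => h0 i j) (sq_nonneg _)
    linarith
  calc _ ≤ ∑ i, deg a i * (f i - m) ^ 2 := h1
    _ ≤ ∑ i, D * (f i - m) ^ 2 :=
      Finset.sum_le_sum fun i _ => mul_le_mul_of_nonneg_right (hD i) (sq_nonneg _)
    _ ≤ D * (8 * D / (c * Fintype.card V) ^ 2 * energy a f) := by
      rw [← Finset.mul_sum]
      exact mul_le_mul_of_nonneg_left hm hD0.le
    _ = _ := by ring

end WeightedGraph

/-! ### Simple random walk: trajectories and first step equations -/

namespace RandomWalk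

variable {V : Type*}

/-- The adjacency weights of a graph. -/
noncomputable def weight (G : SimpleGraph V) (i j : V) : ℝ :=
  open Classical in if G.Adj i j then 1 else 0

lemma weight_symm (G : SimpleGraph V) (i j : V) : weight G i j = weight G j i := by
  unfold weight
  rw [G.adj_comm]

lemma weight_nonneg (G : SimpleGraph V) (i j : V) : 0 ≤ weight G i j := by
  unfold weight
  split_ifs <;> simp

lemma weight_le_one (G : SimpleGraph V) (i j : V) : weight G i j ≤ 1 := by
  unfold weight
  split_ifs <;> simp

lemma weight_self (G : SimpleGraph V) (i : V) : weight G i i = 0 := by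
  simp [weight]

/-- The trajectories which avoid `j` at the times `1, …, n`. -/
def avoids (j : V) (n : ℕ) : Set (ℕ → V) := {ω | ∀ m, 0 < m → m ≤ n → ω m ≠ j}

/-- Tail-sum formula: the first visit exceeds `n` exactly when `j` is avoided at times `1, …, n`. -/
lemma firstVisit_eq_tsum (j : V) (ω : ℕ → V) :
    firstVisit j ω = ∑' n, (avoids j n).indicator 1 ω := by
  classical
  by_cases h : ∃ m, 0 < m ∧ ω m = j
  · have h1 := Nat.find_spec h
    set T := Nat.find h with hT
    have hmin : ∀ m, 0 < m → ω m = j → T ≤ m := fun m h2 h3 => Nat.find_min' h ⟨h2, h3⟩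
    have h2 : firstVisit j ω = T := by
      refine le_antisymm (iInf₂_le T h1) (le_iInf₂ fun m hm => ?_)
      exact_mod_cast hmin m hm.1 hm.2
    have h3 : ∀ n, ω ∈ avoids j n ↔ n ∈ Finset.range T := by
      intro n
      simp only [avoids, Set.mem_ofPred_eq, Finset.mem_range]
      constructor
      · intro h
        by_contra hn
        exact h T h1.1 (not_lt.1 hn) h1.2
      · intro h m h4 h5 h6
        have := hmin m h4 h6
        omega
    rw [h2, tsum_eq_sum (s := Finset.range T) fun n hn => by simp [h3, hn],
      Finset.sum_congr rfl fun n hn => by rw [Set.indicator_of_mem ((h3 n).2 hn)]]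
    simp
  · push Not at h
    have h1 : firstVisit j ω = ⊤ := by
      simp only [firstVisit, iInf_eq_top]
      exact fun m hm => absurd hm.2 (h m hm.1)
    rw [h1]
    have h2 : ∀ n, (avoids j n).indicator (1 : (ℕ → V) → ℝ≥0∞) ω = 1 := fun n =>
      Set.indicator_of_mem (show ω ∈ avoids j n from fun m h3 _ => h m h3) _
    simp [h2]

section

variable [Fintype V]

lemma deg_weight (G : SimpleGraph V) (i : V) :
    WeightedGraph.deg (weight G) i = (G.neighborSet i).ncard := by
  classical
  simp only [WeightedGraph.deg, weight, Finset.sum_boole]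
  rw [← Set.ncard_coe_finset]
  congr 2
  ext
  simp

lemma stationary_eq_ofReal (G : SimpleGraph V)
    (hd : ∀ i, 0 < WeightedGraph.deg (weight G) i) (i : V) :
    stationary G i = ENNReal.ofReal (WeightedGraph.deg (weight G) i /
      ∑ j, WeightedGraph.deg (weight G) j) := by
  classical
  have h1 : ∀ j, WeightedGraph.deg (weight G) j = (G.degree j : ℝ) := fun j => by
    rw [deg_weight, ← SimpleGraph.card_neighborSet_eq_degree, Set.ncard_eq_toFinset_card',
      Set.toFinset_card]
  have h2 : ∑ j, WeightedGraph.deg (weight G) j = ((2 * G.edgeFinset.card : ℕ) : ℝ) := by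
    rw [← SimpleGraph.sum_degrees_eq_twice_card_edges]
    push_cast
    exact Finset.sum_congr rfl fun j _ => h1 j
  have h3 : 0 < ∑ j, WeightedGraph.deg (weight G) j :=
    Finset.sum_pos (fun j _ => hd j) ⟨i, Finset.mem_univ i⟩
  rw [ENNReal.ofReal_div_of_pos h3, h2, h1, ENNReal.ofReal_natCast, ENNReal.ofReal_natCast,
    stationary]
  push_cast
  congr!

/-- The indicator of a connected component has zero energy. -/
lemma connected_of_poincare [Nonempty V] (G : SimpleGraph V) {L : ℝ}
    (hd : ∀ i, 0 < WeightedGraph.deg (weight G) i) (hP : WeightedGraph.Poincare (weight G) L) :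
    G.Connected := by
  classical
  refine ⟨fun i j => ?_⟩
  set f : V → ℝ := fun k => if G.Reachable i k then 1 else 0 with hf
  have he : WeightedGraph.energy (weight G) f = 0 := by
    have : ∀ k l, weight G k l * (f k - f l) ^ 2 = 0 := by
      intro k l
      by_cases h : G.Adj k l
      · have : G.Reachable i k ↔ G.Reachable i l :=
          ⟨fun h1 => h1.trans h.reachable, fun h1 => h1.trans h.symm.reachable⟩
        simp [hf, this]
      · simp [weight, h]
    simp [WeightedGraph.energy, this]
  have := hP.eq_of_energy_eq_zero hd he i j
  by_contra h
  simp [hf, h] at this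

end

variable [MeasurableSpace V] [MeasurableSingletonClass V]

lemma measurableSet_avoids (j : V) (n : ℕ) : MeasurableSet (avoids j n) := by
  have : avoids j n = ⋂ m, ⋂ (_ : 0 < m), ⋂ (_ : m ≤ n), (fun ω : ℕ → V => ω m) ⁻¹' {j}ᶜ := by
    ext ω
    simp [avoids]
  rw [this]
  exact MeasurableSet.iInter fun m => MeasurableSet.iInter fun _ => MeasurableSet.iInter fun _ =>
    measurable_pi_apply m (measurableSet_singleton j).compl

variable [Fintype V]

/-- One step of the walk killed at `j`, acting on functions. -/
noncomputable def killedStep (G : SimpleGraph V) (j : V) (f : V → ℝ≥0∞) (i : V) : ℝ≥0∞ :=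
  ∫⁻ k, ({j}ᶜ : Set V).indicator f k ∂(step G i)

instance (G : SimpleGraph V) (i : V) : IsProbabilityMeasure (walkLaw G i) := by
  unfold walkLaw
  infer_instance

/-- The Markov property at time `n`, for events determined by the past. -/
lemma lintegral_walkLaw_succ (G : SimpleGraph V) (i : V) (n : ℕ)
    {A : Set (Finset.Iic n → V)} (f : V → ℝ≥0∞) :
    ∫⁻ ω, A.indicator 1 (Preorder.frestrictLe n ω) * f (ω (n + 1)) ∂(walkLaw G i) =
      ∫⁻ ω, A.indicator 1 (Preorder.frestrictLe n ω) * (∫⁻ k, f k ∂(step G (ω n)))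
        ∂(walkLaw G i) := by
  have hf : Measurable f := measurable_of_finite f
  have h := Kernel.map_frestrictLe_trajMeasure_compProd_eq_map_trajMeasure
    (X := fun _ => V) (μ₀ := Measure.dirac i) (κ := stepKernel G) (a := n)
  have hF : Measurable fun x : (Finset.Iic n → V) × V =>
      A.indicator (1 : (Finset.Iic n → V) → ℝ≥0∞) x.1 * f x.2 := by
    have : Measurable (A.indicator (1 : (Finset.Iic n → V) → ℝ≥0∞)) := measurable_of_finite _
    fun_prop
  have h2 := congrArg (fun μ : Measure ((Finset.Iic n → V) × V) =>
    ∫⁻ x, A.indicator (1 : (Finset.Iic n → V) → ℝ≥0∞) x.1 * f x.2 ∂μ) h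
  rw [lintegral_map hF (by fun_prop), Measure.lintegral_compProd hF,
    lintegral_map (measurable_of_finite _) (by fun_prop)] at h2
  rw [walkLaw, ← h2]
  refine lintegral_congr fun ω => ?_
  simp only [lintegral_const_mul _ hf]
  rfl

lemma lintegral_avoids (G : SimpleGraph V) (i j : V) (n : ℕ) (f : V → ℝ≥0∞) :
    ∫⁻ ω, (avoids j n).indicator 1 ω * f (ω n) ∂(walkLaw G i) = (killedStep G j)^[n] f i := by
  induction n generalizing f with
  | zero =>
    have h0 : ∫⁻ ω, f (ω 0) ∂(walkLaw G i) = f i := by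
      have h1 : (walkLaw G i).map (Preorder.frestrictLe 0) =
          (Measure.dirac i).map (MeasurableEquiv.piUnique fun _ : Finset.Iic 0 => V).symm := by
        rw [walkLaw, Kernel.trajMeasure, Measure.map_comp _ _ (Preorder.measurable_frestrictLe 0),
          Kernel.traj_map_frestrictLe, Kernel.partialTraj_self, Measure.id_comp]
      have h2 : ∫⁻ ω, f (ω 0) ∂(walkLaw G i) = ∫⁻ x, f (x ⟨0, Finset.mem_Iic.2 le_rfl⟩)
          ∂((walkLaw G i).map (Preorder.frestrictLe 0)) :=
        (lintegral_map (f := fun x : Finset.Iic 0 → V => f (x ⟨0, Finset.mem_Iic.2 le_rfl⟩))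
          (measurable_of_finite _) (Preorder.measurable_frestrictLe (X := fun _ => V) 0)).symm
      rw [h2, h1, lintegral_map (measurable_of_finite _) (MeasurableEquiv.measurable _),
        lintegral_dirac]
      rfl
    have : avoids j 0 = Set.univ := by
      ext ω
      simp only [avoids, Set.mem_ofPred_eq, Set.mem_univ, iff_true]
      omega
    simpa [this] using h0
  | succ n ih =>
    set A : Set (Finset.Iic n → V) :=
      {x | ∀ m (hm : m ∈ Finset.Iic n), 0 < m → x ⟨m, hm⟩ ≠ j} with hA
    have hAn : ∀ ω, A.indicator (1 : (Finset.Iic n → V) → ℝ≥0∞) (Preorder.frestrictLe n ω) =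
        (avoids j n).indicator 1 ω := by
      intro ω
      simp only [Set.indicator, hA, avoids, Set.mem_ofPred_eq]
      congr 1
      simp only [eq_iff_iff]
      exact ⟨fun h m h1 h2 => h m (Finset.mem_Iic.2 h2) h1,
        fun h m h1 h2 => h m h2 (Finset.mem_Iic.1 h1)⟩
    rw [Function.iterate_succ_apply, ← ih]
    have h := lintegral_walkLaw_succ G i n (A := A) (({j}ᶜ : Set V).indicator f)
    simp only [hAn] at h
    rw [← show _ = ∫⁻ ω, (avoids j n).indicator 1 ω * killedStep G j f (ω n) ∂(walkLaw G i)
      from h]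
    refine lintegral_congr fun ω => ?_
    have : ω ∈ avoids j (n + 1) ↔ ω ∈ avoids j n ∧ ω (n + 1) ≠ j := by
      simp only [avoids, Set.mem_ofPred_eq]
      constructor
      · exact fun h => ⟨fun m h1 h2 => h m h1 (by omega), h _ (by omega) le_rfl⟩
      · rintro ⟨h1, h2⟩ m h3 h4
        rcases Nat.le_succ_iff.1 h4 with h5 | rfl
        · exact h1 m h3 h5
        · exact h2
    by_cases h1 : ω ∈ avoids j n <;> by_cases h2 : ω (n + 1) = j <;> simp [this, h1, h2]

lemma hittingTime_eq_tsum (G : SimpleGraph V) (i j : V) :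
    hittingTime G i j = ∑' n, (killedStep G j)^[n] 1 i := by
  unfold hittingTime
  simp only [firstVisit_eq_tsum]
  rw [lintegral_tsum fun n =>
    (measurable_one.indicator (measurableSet_avoids j n)).aemeasurable]
  refine tsum_congr fun n => ?_
  rw [← lintegral_avoids]
  simp

/-- The first step equation. -/
lemma hittingTime_eq (G : SimpleGraph V) (i j : V) :
    hittingTime G i j = 1 + killedStep G j (hittingTime G · j) i := by
  rw [hittingTime_eq_tsum, tsum_eq_zero_add' ENNReal.summable]
  simp only [Function.iterate_zero, id, Pi.one_apply]
  congr 1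
  simp only [Function.iterate_succ_apply', killedStep]
  rw [← lintegral_tsum fun n => (measurable_of_finite _).aemeasurable]
  refine lintegral_congr fun k => ?_
  by_cases h : k = j
  · simp [h]
  · simp only [Set.indicator_of_mem (show k ∈ ({j}ᶜ : Set V) from h), hittingTime_eq_tsum]

/-- The hitting time is the minimal nonnegative supersolution: its partial sums stay below `f` by
induction. This is how finiteness is obtained. -/
lemma hittingTime_le (G : SimpleGraph V) (j : V) {f : V → ℝ≥0∞}
    (hf : ∀ i, 1 + killedStep G j f i ≤ f i) (i : V) : hittingTime G i j ≤ f i := by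
  rw [hittingTime_eq_tsum]
  refine ENNReal.tsum_le_of_sum_range_le fun n => ?_
  induction n generalizing i with
  | zero => simp
  | succ n ih =>
    rw [Finset.sum_range_succ']
    simp only [Function.iterate_succ_apply', Function.iterate_zero, id, Pi.one_apply]
    rw [add_comm]
    refine le_trans (add_le_add_right ?_ _) (hf i)
    simp only [killedStep]
    rw [← lintegral_finsetSum _ fun n _ => measurable_of_finite _]
    refine lintegral_mono fun k => ?_
    by_cases h : k = j
    · simp [h]
    · simp only [Set.indicator_of_mem (show k ∈ ({j}ᶜ : Set V) from h)]
      exact ih k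

lemma step_singleton (G : SimpleGraph V) {i : V} (hi : 0 < WeightedGraph.deg (weight G) i)
    (k : V) : step G i {k} = ENNReal.ofReal (weight G i k / WeightedGraph.deg (weight G) i) := by
  classical
  rw [deg_weight] at hi ⊢
  have hne : (G.neighborSet i).Nonempty := by
    rw [← Set.ncard_pos]
    exact_mod_cast hi
  have hs : G.neighborSet i = ((Finset.univ.filter (G.Adj i) : Finset V) : Set V) := by
    ext
    simp
  rw [step, if_pos hne, hs, ← Finset.coe_singleton, uniformOn_apply_finset, Set.ncard_coe_finset,
    ENNReal.ofReal_div_of_pos (by rwa [hs, Set.ncard_coe_finset] at hi), ENNReal.ofReal_natCast]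
  congr 1
  by_cases h : G.Adj i k <;> simp [weight, h]

lemma lintegral_step [DecidableEq V] (G : SimpleGraph V) {i : V}
    (hi : 0 < WeightedGraph.deg (weight G) i) {f : V → ℝ} (hf : ∀ k, 0 ≤ f k) :
    ∫⁻ k, ENNReal.ofReal (f k) ∂(step G i) =
      ENNReal.ofReal (WeightedGraph.avg (weight G) f i) := by
  rw [lintegral_fintype, WeightedGraph.avg, Finset.sum_div, ENNReal.ofReal_sum_of_nonneg]
  · refine Finset.sum_congr rfl fun k _ => ?_
    rw [step_singleton G hi, ← ENNReal.ofReal_mul (hf k)]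
    congr 1
    ring
  · exact fun k _ => div_nonneg (mul_nonneg (by unfold weight; split_ifs <;> simp) (hf k)) hi.le

lemma killedStep_ofReal [DecidableEq V] (G : SimpleGraph V) (j : V) {i : V}
    (hi : 0 < WeightedGraph.deg (weight G) i) {f : V → ℝ} (hf : ∀ k, 0 ≤ f k) :
    killedStep G j (fun k => ENNReal.ofReal (f k)) i =
      ENNReal.ofReal (WeightedGraph.avg (weight G) (fun k => if k = j then 0 else f k) i) := by
  rw [← lintegral_step G hi fun k => by split_ifs <;> simp [hf]]
  refine lintegral_congr fun k => ?_
  by_cases h : k = j <;> simp [h]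

/-- The solution from linear algebra serves only to bound the hitting time. Once that is finite, its
own real values satisfy the first step equations. -/
lemma exists_hittingTime_eq_ofReal [DecidableEq V] (G : SimpleGraph V) {L : ℝ}
    (hd : ∀ i, 0 < WeightedGraph.deg (weight G) i) (hP : WeightedGraph.Poincare (weight G) L)
    (j : V) : ∃ f : V → ℝ, WeightedGraph.IsHitting (weight G) j f ∧ (∀ i, 0 ≤ f i) ∧
      ∀ i, hittingTime G i j = ENNReal.ofReal (f i) := by
  obtain ⟨g, hg, hg0⟩ := WeightedGraph.exists_isHitting (weight_symm G) (weight_nonneg G) hd hP j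
  have havg : ∀ {f : V → ℝ}, (∀ k, 0 ≤ f k) → ∀ i,
      0 ≤ WeightedGraph.avg (weight G) (fun k => if k = j then 0 else f k) i := fun hf i =>
    div_nonneg (Finset.sum_nonneg fun k _ => mul_nonneg (weight_nonneg G i k)
      (by dsimp only; split_ifs <;> simp [hf])) (hd i).le
  have hle : ∀ i, hittingTime G i j ≤ ENNReal.ofReal (g i) := by
    refine hittingTime_le G j fun i => ?_
    rw [killedStep_ofReal G j (hd i) hg0, ← ENNReal.ofReal_one,
      ← ENNReal.ofReal_add zero_le_one (havg hg0 i), ← hg i]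
  have hfin : ∀ i, hittingTime G i j ≠ ⊤ := fun i =>
    ne_top_of_le_ne_top ENNReal.ofReal_ne_top (hle i)
  have hf0 : ∀ i, 0 ≤ (hittingTime G i j).toReal := fun i => ENNReal.toReal_nonneg
  have heq : ∀ i, ENNReal.ofReal (hittingTime G i j).toReal = hittingTime G i j := fun i =>
    ENNReal.ofReal_toReal (hfin i)
  refine ⟨fun i => (hittingTime G i j).toReal, fun i => ?_, hf0, fun i => (heq i).symm⟩
  have h := hittingTime_eq G i j
  have h2 := killedStep_ofReal G j (hd i) hf0
  simp only [heq] at h2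
  rw [h2, ← ENNReal.ofReal_one, ← ENNReal.ofReal_add zero_le_one (havg hf0 i)] at h
  exact (congrArg ENNReal.toReal h).trans (ENNReal.toReal_ofReal (add_nonneg zero_le_one (havg hf0 i)))

theorem startingTime_bounds (G : SimpleGraph V) {L δ : ℝ} (hδ : 0 < δ)
    (hdδ : ∀ i, δ ≤ WeightedGraph.deg (weight G) i)
    (hP : WeightedGraph.Poincare (weight G) L) (hL : 0 < L) (i : V) :
    ENNReal.ofReal (Fintype.card V - 1) ≤ startingTime G i ∧
      startingTime G i ≤ ENNReal.ofReal (Fintype.card V - 1 + Fintype.card V * (L / δ)) := by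
  classical
  have hd : ∀ i, 0 < WeightedGraph.deg (weight G) i := fun i => hδ.trans_le (hdδ i)
  choose h hh h0 hhit using exists_hittingTime_eq_ofReal G hd hP
  have hs : startingTime G i = ENNReal.ofReal (∑ j, WeightedGraph.deg (weight G) j /
      (∑ j, WeightedGraph.deg (weight G) j) * h j i) := by
    have hπ : ∀ j, 0 ≤ WeightedGraph.deg (weight G) j /
        (∑ j, WeightedGraph.deg (weight G) j) := fun j =>
      div_nonneg (hd j).le (Finset.sum_nonneg fun k _ => (hd k).le)
    rw [ENNReal.ofReal_sum_of_nonneg fun j _ => mul_nonneg (hπ j) (h0 j i)]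
    exact Finset.sum_congr rfl fun j _ => by
      rw [ENNReal.ofReal_mul (hπ j), stationary_eq_ofReal G hd, hhit]
  have hb := WeightedGraph.sum_hitting_bounds (weight_symm G) (weight_nonneg G)
    (weight_le_one G) (weight_self G) hδ hdδ hP hL (h := fun i j => h j i) hh rfl i
  rw [hs]
  exact ⟨ENNReal.ofReal_le_ofReal hb.1, ENNReal.ofReal_le_ofReal hb.2⟩

end RandomWalk

/-! ### Independence of edges in the random graph -/

namespace SimpleGraph

variable {V : Type*} [Fintype V] [DecidableEq V]

instance {V : Type*} [Countable V] : MeasurableSingletonClass (SimpleGraph V) where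
  measurableSet_singleton G := by
    rw [← edgeSet_injective.preimage_image {G}, Set.image_singleton]
    exact measurable_edgeSet (measurableSet_singleton _)

lemma integral_binomialRandom (p : unitInterval) (F : Finset (Sym2 V) → ℝ) :
    ∫ G, F (open Classical in G.edgeFinset) ∂(binomialRandom V p) =
      ∑ s ∈ (Finset.univ.filter fun e : Sym2 V => ¬ e.IsDiag).powerset,
        (p : ℝ) ^ s.card *
          (1 - p : ℝ) ^ ((Finset.univ.filter fun e : Sym2 V => ¬ e.IsDiag) \ s).card * F s := by
  classical
  rw [integral_fintype Integrable.of_finite]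
  refine Finset.sum_bij' (fun G _ => G.edgeFinset) (fun s _ => fromEdgeSet (s : Set (Sym2 V)))
    ?_ ?_ ?_ ?_ ?_
  · intro G _
    rw [Finset.mem_powerset]
    intro e he
    simpa using G.not_isDiag_of_mem_edgeFinset he
  · simp
  · intro G _
    simp
  · intro s hs
    rw [Finset.mem_powerset] at hs
    ext e
    refine (@Set.mem_toFinset _ _ (_) e).trans ?_
    rw [edgeSet_fromEdgeSet]
    simp only [Set.mem_sdiff, Finset.mem_coe]
    exact ⟨fun h => h.1, fun h => ⟨h, by simpa using hs h⟩⟩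
  · intro G _
    have h1 : G.edgeSet ⊆ Sym2.diagSetᶜ := edgeSet_subset_compl_diagSet G
    rw [measureReal_def, binomialRandom_apply', Set.image_singleton, ← measureReal_def,
      setBernoulli_real_singleton p h1 (Set.toFinite _), smul_eq_mul]
    congr 3
    · rw [Set.ncard_eq_toFinset_card']
      rfl
    · rw [← Set.ncard_coe_finset]
      congr 1
      ext e
      simp

/-- Expand the product over all potential edges of `p * x_e + (1 - p)`, where `x_e` is `x` on `T`
and `1` elsewhere. -/
lemma integral_prod_binomialRandom (p : unitInterval) (T : Finset (Sym2 V))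
    (hT : ∀ e ∈ T, ¬ e.IsDiag) (x : ℝ) :
    ∫ G, (∏ e ∈ T, open Classical in if e ∈ G.edgeFinset then x else 1) ∂(binomialRandom V p) =
      (1 - p + p * x : ℝ) ^ T.card := by
  classical
  rw [integral_binomialRandom p fun s => ∏ e ∈ T, if e ∈ s then x else 1]
  set u := Finset.univ.filter fun e : Sym2 V => ¬ e.IsDiag with hu
  have hTu : T ⊆ u := fun e he => by simpa [hu] using hT e he
  have h1 : ∏ e ∈ u, ((p : ℝ) * (if e ∈ T then x else 1) + (1 - p)) =
      (1 - p + p * x : ℝ) ^ T.card := by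
    rw [← Finset.prod_subset hTu fun e _ he => by simp [he], ← Finset.prod_const]
    exact Finset.prod_congr rfl fun e he => by rw [if_pos he]; ring
  rw [← h1, Finset.prod_add]
  refine Finset.sum_congr rfl fun s hs => ?_
  rw [Finset.mem_powerset] at hs
  rw [Finset.prod_mul_distrib, Finset.prod_const, Finset.prod_const,
    mul_right_comm, Finset.prod_ite_mem, Finset.prod_ite_mem, Finset.inter_comm]

end SimpleGraph

/-! ### Chernoff bounds for cuts -/

namespace RandomWalk

variable {V : Type*} [Fintype V] [DecidableEq V]

/-- The number of edges between `S` and its complement. -/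
noncomputable def cut (S : Finset V) (G : SimpleGraph V) : ℝ := ∑ i ∈ S, ∑ j ∈ Sᶜ, weight G i j

lemma mgf_cut (p : unitInterval) (S : Finset V) (t : ℝ) :
    mgf (cut S) (SimpleGraph.binomialRandom V p) t =
      (1 - p + p * Real.exp t : ℝ) ^ (S.card * (Sᶜ).card) := by
  classical
  set T := (S ×ˢ Sᶜ).image fun x => s(x.1, x.2) with hT
  have hinj : Set.InjOn (fun x : V × V => s(x.1, x.2)) (S ×ˢ Sᶜ : Finset (V × V)) := by
    rintro ⟨x, y⟩ hxy ⟨z, w⟩ hzw h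
    simp only [Finset.coe_product, Set.mem_prod, Finset.mem_coe, Finset.mem_compl] at hxy hzw
    rcases Sym2.eq_iff.1 h with ⟨rfl, rfl⟩ | ⟨rfl, rfl⟩
    · rfl
    · exact absurd hxy.1 hzw.2
  have hcard : T.card = S.card * (Sᶜ).card := by
    rw [hT, Finset.card_image_of_injOn hinj, Finset.card_product]
  rw [← hcard, ← SimpleGraph.integral_prod_binomialRandom p T ?_, mgf]
  · refine integral_congr_ae (.of_forall fun G => ?_)
    simp only
    rw [hT, Finset.prod_image hinj, Finset.prod_product, cut, Finset.mul_sum, Real.exp_sum]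
    refine Finset.prod_congr rfl fun i _ => ?_
    rw [Finset.mul_sum, Real.exp_sum]
    refine Finset.prod_congr rfl fun j _ => ?_
    by_cases h : G.Adj i j <;> simp [weight, h]
  · intro e he
    rw [hT, Finset.mem_image] at he
    obtain ⟨⟨x, y⟩, hxy, rfl⟩ := he
    rw [Finset.mem_product, Finset.mem_compl] at hxy
    rintro (h : x = y)
    exact hxy.2 (h ▸ hxy.1)

lemma mgf_cut_le (p : unitInterval) (S : Finset V) (t : ℝ) :
    mgf (cut S) (SimpleGraph.binomialRandom V p) t ≤
      Real.exp ((S.card * (Sᶜ).card) * p * (Real.exp t - 1)) := by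
  have h1 : (1 - p + p * Real.exp t : ℝ) ≤ Real.exp (p * (Real.exp t - 1)) := by
    have := Real.add_one_le_exp ((p : ℝ) * (Real.exp t - 1))
    linarith
  have h0 : 0 ≤ (1 - p + p * Real.exp t : ℝ) :=
    add_nonneg (sub_nonneg.2 p.2.2) (mul_nonneg p.2.1 (Real.exp_pos t).le)
  rw [mgf_cut]
  refine (pow_le_pow_left₀ h0 h1 _).trans_eq ?_
  rw [← Real.exp_nat_mul]
  push_cast
  ring_nf

lemma measure_cut_le (p : unitInterval) (S : Finset V) :
    (SimpleGraph.binomialRandom V p).real {G | cut S G ≤ (p : ℝ) / 2 * (S.card * (Sᶜ).card)} ≤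
      Real.exp (-(p * (S.card * (Sᶜ).card) / 10)) := by
  refine (measure_le_le_exp_mul_mgf (t := -1) _ (by norm_num) Integrable.of_finite).trans ?_
  refine (mul_le_mul_of_nonneg_left (mgf_cut_le p S (-1)) (Real.exp_pos _).le).trans ?_
  rw [← Real.exp_add, Real.exp_le_exp]
  -- The exponent is at most `1/2 + 0.4 - 1 = -1/10` times the expected cut.
  have h1 : Real.exp (-1) ≤ 0.4 := Real.exp_neg_one_lt_d9.le.trans (by norm_num)
  have h2 : 0 ≤ (S.card * (Sᶜ).card) * (p : ℝ) := mul_nonneg (by positivity) p.2.1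
  nlinarith

lemma measure_le_cut (p : unitInterval) (S : Finset V) :
    (SimpleGraph.binomialRandom V p).real {G | 3 * (p : ℝ) * (S.card * (Sᶜ).card) ≤ cut S G} ≤
      Real.exp (-(p * (S.card * (Sᶜ).card))) := by
  refine (measure_ge_le_exp_mul_mgf (t := 1) _ (by norm_num) Integrable.of_finite).trans ?_
  refine (mul_le_mul_of_nonneg_left (mgf_cut_le p S 1) (Real.exp_pos _).le).trans ?_
  rw [← Real.exp_add, Real.exp_le_exp]
  -- The exponent is at most `-3 + (3 - 1) = -1` times the expected cut.
  have h1 : Real.exp 1 ≤ 3 := Real.exp_one_lt_d9.le.trans (by norm_num)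
  have h2 : 0 ≤ (S.card * (Sᶜ).card) * (p : ℝ) := mul_nonneg (by positivity) p.2.1
  nlinarith

lemma cut_compl (S : Finset V) (G : SimpleGraph V) : cut Sᶜ G = cut S G := by
  rw [cut, cut, Finset.sum_comm, compl_compl]
  exact Finset.sum_congr rfl fun i _ => Finset.sum_congr rfl fun j _ => weight_symm G j i

lemma cut_singleton (i : V) (G : SimpleGraph V) :
    cut {i} G = WeightedGraph.deg (weight G) i := by
  rw [cut, Finset.sum_singleton, WeightedGraph.deg, ← Finset.sum_add_sum_compl {i},
    Finset.sum_singleton, weight_self, zero_add]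

/-- All cuts of the graph have at least half of the expected size, and all degrees are at most
three times as large as expected. -/
def HasTypicalCuts (p : ℝ) (G : SimpleGraph V) : Prop :=
  (∀ S : Finset V, p / 2 * (S.card * (Sᶜ).card) ≤ cut S G) ∧
    ∀ i, WeightedGraph.deg (weight G) i ≤ 3 * p * Fintype.card V

/-- By complementation only sets with at most half the vertices matter. Each fails with probability
at most `q ^ S.card`, and the binomial theorem sums these to `(1 + q) ^ N - 1`, the empty set being
excluded. Degrees add `N * q`. -/
lemma measure_not_hasTypicalCuts_le (p : unitInterval) (hV : 2 ≤ Fintype.card V) {q : ℝ}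
    (hq : q = Real.exp (-(p * Fintype.card V / 20))) :
    (SimpleGraph.binomialRandom V p).real {G | ¬ HasTypicalCuts p G} ≤
      Real.exp (Fintype.card V * q) - 1 + Fintype.card V * q := by
  set N := Fintype.card V with hN
  have hN2 : (2 : ℝ) ≤ N := by exact_mod_cast hV
  set 𝒮 : Finset (Finset V) := Finset.univ.filter fun S => S.Nonempty ∧ S.card ≤ (Sᶜ).card
  have hsub : {G : SimpleGraph V | ¬ HasTypicalCuts p G} ⊆
      (⋃ S ∈ 𝒮, {G | cut S G ≤ (p : ℝ) / 2 * (S.card * (Sᶜ).card)}) ∪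
      ⋃ i ∈ (Finset.univ : Finset V),
        {G | 3 * (p : ℝ) * (({i} : Finset V).card * (({i} : Finset V)ᶜ).card) ≤ cut {i} G} := by
    intro G hG
    by_contra h
    simp only [Set.mem_union, Set.mem_iUnion, Set.mem_ofPred_eq, not_or, not_exists, not_le] at h
    refine hG ⟨?_, fun i => ?_⟩
    · have key : ∀ S : Finset V, S.card ≤ (Sᶜ).card →
          (p : ℝ) / 2 * (S.card * (Sᶜ).card) ≤ cut S G := by
        intro S hS
        rcases S.eq_empty_or_nonempty with rfl | hne
        · simp [cut]
        · exact (h.1 S (by simp [𝒮, hne, hS])).le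
      intro S
      rcases le_total S.card (Sᶜ).card with hS | hS
      · exact key S hS
      · have := key Sᶜ (by rwa [compl_compl])
        rwa [cut_compl, compl_compl, mul_comm ((Sᶜ).card : ℝ)] at this
    · have h1 := h.2 i (Finset.mem_univ i)
      rw [cut_singleton] at h1
      refine h1.le.trans (mul_le_mul_of_nonneg_left ?_ (mul_nonneg (by norm_num) p.2.1))
      rw [Finset.card_singleton, Nat.cast_one, one_mul]
      exact_mod_cast Finset.card_le_univ _
  have hcompl : ∀ S : Finset V, ((Sᶜ).card : ℝ) = N - S.card := fun S => by
    rw [Finset.card_compl, Nat.cast_sub (Finset.card_le_univ S)]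
  have h1 : ∑ S ∈ 𝒮, (SimpleGraph.binomialRandom V p).real
      {G | cut S G ≤ (p : ℝ) / 2 * (S.card * (Sᶜ).card)} ≤ Real.exp (N * q) - 1 := by
    have h2 : ∀ S ∈ 𝒮, (SimpleGraph.binomialRandom V p).real
        {G | cut S G ≤ (p : ℝ) / 2 * (S.card * (Sᶜ).card)} ≤ q ^ S.card := by
      intro S hS
      refine (measure_cut_le p S).trans ?_
      rw [hq, ← Real.exp_nat_mul, Real.exp_le_exp]
      have h3 : (S.card : ℝ) ≤ (Sᶜ).card := by
        exact_mod_cast (Finset.mem_filter.1 hS).2.2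
      rw [hcompl] at h3 ⊢
      have h4 : 0 ≤ (p : ℝ) * S.card := mul_nonneg p.2.1 (by positivity)
      nlinarith
    have h3 : ∑ S : Finset V, q ^ S.card = (q + 1) ^ N := by
      simpa using Fintype.sum_pow_mul_eq_add_pow V q 1
    have hq0 : 0 < q := hq ▸ Real.exp_pos _
    have h4 : ∑ S ∈ 𝒮, q ^ S.card + 1 ≤ ∑ S : Finset V, q ^ S.card := by
      rw [← Finset.add_sum_erase _ _ (Finset.mem_univ ∅), Finset.card_empty, pow_zero, add_comm]
      refine add_le_add_right (Finset.sum_le_sum_of_subset_of_nonneg (fun S hS => ?_)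
        fun S _ _ => by positivity) _
      exact Finset.mem_erase.2 ⟨(Finset.mem_filter.1 hS).2.1.ne_empty, Finset.mem_univ _⟩
    have h5 : (q + 1) ^ N ≤ Real.exp (N * q) := by
      rw [Real.exp_nat_mul]
      exact pow_le_pow_left₀ (by positivity) (Real.add_one_le_exp q) _
    linarith [Finset.sum_le_sum h2]
  have h2 : ∑ i : V, (SimpleGraph.binomialRandom V p).real
      {G | 3 * (p : ℝ) * (({i} : Finset V).card * (({i} : Finset V)ᶜ).card) ≤ cut {i} G} ≤ N * q := by
    have h3 : ∀ i ∈ (Finset.univ : Finset V), (SimpleGraph.binomialRandom V p).real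
        {G | 3 * (p : ℝ) * (({i} : Finset V).card * (({i} : Finset V)ᶜ).card) ≤ cut {i} G} ≤ q := by
      intro i _
      refine (measure_le_cut p {i}).trans ?_
      rw [hq, Real.exp_le_exp, hcompl, Finset.card_singleton, Nat.cast_one]
      nlinarith [p.2.1]
    refine (Finset.sum_le_sum h3).trans_eq ?_
    rw [Finset.sum_const, nsmul_eq_mul, Finset.card_univ]
  calc _ ≤ _ := measureReal_mono hsub
    _ ≤ _ := measureReal_union_le _ _
    _ ≤ _ := add_le_add ((measureReal_biUnion_finset_le _ _).trans h1)
      ((measureReal_biUnion_finset_le _ _).trans h2)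

end RandomWalk

/-! ### Typical cuts give the Poincaré constant and the starting time -/

namespace RandomWalk

lemma HasTypicalCuts.poincare {V : Type*} [Fintype V] [DecidableEq V] [Nonempty V] {p : ℝ}
    (hp : 0 < p) {G : SimpleGraph V} (hG : HasTypicalCuts p G) :
    WeightedGraph.Poincare (weight G) 288 := by
  have hN : 0 < (Fintype.card V : ℝ) := by exact_mod_cast Fintype.card_pos
  have h := WeightedGraph.poincare_of_cut (weight_symm G) (weight_nonneg G) (half_pos hp)
    (D := 3 * p * Fintype.card V) (by positivity) hG.2 hG.1
  have h2 : (8 * (3 * p * Fintype.card V / (p / 2 * Fintype.card V)) ^ 2 : ℝ) = 288 := by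
    have : 3 * p * Fintype.card V / (p / 2 * Fintype.card V) = 6 := by
      field_simp
      norm_num
    rw [this]
    norm_num
  rwa [h2] at h

lemma HasTypicalCuts.le_deg {V : Type*} [Fintype V] [DecidableEq V] {p : ℝ}
    (hp : 0 < p) (hV : 2 ≤ Fintype.card V) {G : SimpleGraph V} (hG : HasTypicalCuts p G) (i : V) :
    p * Fintype.card V / 4 ≤ WeightedGraph.deg (weight G) i := by
  have h := hG.1 {i}
  rw [cut_singleton, Finset.card_compl, Finset.card_singleton,
    Nat.cast_sub (one_le_two.trans hV)] at h
  have : (2 : ℝ) ≤ Fintype.card V := by exact_mod_cast hV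
  push_cast at h
  nlinarith

/-- A graph with typical cuts is connected, and its random starting times are close to the number
of vertices. -/
lemma HasTypicalCuts.startingTime {V : Type*} [Fintype V] [DecidableEq V] [MeasurableSpace V]
    [MeasurableSingletonClass V] {p ε : ℝ} (hp : 0 < p) (hV : 2 ≤ Fintype.card V)
    (hε : 1 ≤ ε * Fintype.card V) (hpε : 1152 ≤ ε * (p * Fintype.card V))
    {G : SimpleGraph V} (hG : HasTypicalCuts p G) :
    G.Connected ∧ ∀ i, ENNReal.ofReal ((1 - ε) * Fintype.card V) ≤ startingTime G i ∧
      startingTime G i ≤ ENNReal.ofReal ((1 + ε) * Fintype.card V) := by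
  have : Nonempty V := Fintype.card_pos_iff.1 (two_pos.trans_le hV)
  have hN : 0 < (Fintype.card V : ℝ) := by exact_mod_cast Fintype.card_pos
  have hδ : 0 < p * Fintype.card V / 4 := by positivity
  have hP := hG.poincare hp
  refine ⟨connected_of_poincare G (fun i => hδ.trans_le (hG.le_deg hp hV i)) hP, fun i => ?_⟩
  obtain ⟨h1, h2⟩ := startingTime_bounds G hδ (hG.le_deg hp hV) hP (by norm_num) i
  refine ⟨(ENNReal.ofReal_le_ofReal ?_).trans h1, h2.trans (ENNReal.ofReal_le_ofReal ?_)⟩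
  · linarith
  · have h3 : 288 / (p * Fintype.card V / 4) ≤ ε := by
      rw [div_le_iff₀ hδ]
      linarith
    nlinarith [mul_le_mul_of_nonneg_left h3 hN.le]

end RandomWalk

/-! ### Asymptotics in `N` -/

lemma tendsto_card_mul_exp {p : ℕ → unitInterval}
    (hp : ∀ᶠ N : ℕ in atTop, 40 * Real.log N ≤ p N * N) :
    Tendsto (fun N : ℕ => N * Real.exp (-(p N * N / 20))) atTop (𝓝 0) := by
  refine squeeze_zero' (.of_forall fun N => by positivity) ?_
    tendsto_inv_atTop_nhds_zero_nat
  filter_upwards [hp, eventually_gt_atTop 0] with N hN h0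
  have hN0 : (0 : ℝ) < N := by exact_mod_cast h0
  calc (N : ℝ) * Real.exp (-(p N * N / 20)) ≤ N * Real.exp (-(2 * Real.log N)) := by
        gcongr
        linarith
    _ = N * ((N : ℝ) ^ 2)⁻¹ := by
        rw [Real.exp_neg, two_mul, Real.exp_add, Real.exp_log hN0, sq]
    _ = (N : ℝ)⁻¹ := by
        field_simp

lemma eventually_mul_log_le {ξ : ℕ → ℝ} (hξ : ∀ᶠ N : ℕ in atTop, 1 ≤ ξ N)
    {p : ℕ → unitInterval} (hp : ∀ᶠ N : ℕ in atTop, 0 < p N)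
    (h : Tendsto (fun N : ℕ => Real.log N ^ (2 * 1 * ξ N) / (N * (p N : ℝ))) atTop (𝓝 0))
    {c : ℝ} (hc : 0 < c) : ∀ᶠ N : ℕ in atTop, c * Real.log N ≤ p N * N := by
  have hlog : ∀ᶠ N : ℕ in atTop, 1 ≤ Real.log N :=
    (Real.tendsto_log_atTop.comp tendsto_natCast_atTop_atTop).eventually_ge_atTop 1
  filter_upwards [hξ, hp, hlog, eventually_gt_atTop 0,
    h.eventually (eventually_lt_nhds (inv_pos.2 hc))] with N h1 h2 h3 h4 h5
  have hN0 : (0 : ℝ) < N := by exact_mod_cast h4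
  have hp0 : (0 : ℝ) < p N := h2
  rw [div_lt_iff₀ (by positivity)] at h5
  have h6 : Real.log N ≤ Real.log N ^ (2 * 1 * ξ N) := by
    conv_lhs => rw [← Real.rpow_one (Real.log N)]
    exact Real.rpow_le_rpow_of_exponent_le h3 (by linarith)
  calc c * Real.log N ≤ c * (c⁻¹ * (N * p N)) := 
        mul_le_mul_of_nonneg_left (h6.trans h5.le) hc.le
    _ = p N * N := by field_simp

theorem theorem3 (a₀ a₁ : ℝ) (ha₀ : 0 < a₀) (ha₁ : 10 ≤ a₁) :
    ∃ C : ℝ, 0 < C ∧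
      ∀ ξ : ℕ → ℝ,
        (∀ᶠ N : ℕ in atTop, 1 + a₀ ≤ ξ N ∧ ξ N ≤ a₁ * Real.log (Real.log N)) →
      ∀ p : ℕ → unitInterval,
        (∀ᶠ N : ℕ in atTop, 0 < p N) →
        Tendsto (fun N : ℕ => Real.log N ^ (2 * C * ξ N) / (N * (p N : ℝ))) atTop (𝓝 0) →
      ∀ ε : ℝ, 0 < ε →
        Tendsto
          (fun N : ℕ => SimpleGraph.binomialRandom (Fin N) (p N)
            {G : SimpleGraph (Fin N) | G.Connected ∧ ∀ i : Fin N,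
              ENNReal.ofReal ((1 - ε) * N) ≤ RandomWalk.startingTime G i ∧
              RandomWalk.startingTime G i ≤ ENNReal.ofReal ((1 + ε) * N)})
          atTop (𝓝 1) := by
  -- `C = 1` suffices: since `ξ ≥ 1`, the power of `log N` dominates `log N`, so `p N` eventually
  -- exceeds every multiple of `log N`.
  refine ⟨1, one_pos, fun ξ hξ p hp h ε hε => ?_⟩
  have hlog := fun {c : ℝ} (hc : 0 < c) =>
    eventually_mul_log_le (hξ.mono fun N h => by linarith [h.1]) hp h hc
  set x : ℕ → ℝ := fun N => N * Real.exp (-(p N * N / 20)) with hx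
  have hbad : Tendsto (fun N => Real.exp (x N) - 1 + x N) atTop (𝓝 0) := by
    have hx0 := tendsto_card_mul_exp (hlog (c := 40) (by norm_num))
    simpa using ((Real.continuous_exp.tendsto 0 |>.comp hx0).sub_const 1).add hx0
  have hlow : Tendsto (fun N => 1 - ENNReal.ofReal (Real.exp (x N) - 1 + x N)) atTop (𝓝 1) := by
    have := ENNReal.Tendsto.sub (tendsto_const_nhds (x := (1 : ℝ≥0∞)))
      (ENNReal.tendsto_ofReal hbad) (.inl ENNReal.one_ne_top)
    simpa using this
  have hlog1 : ∀ᶠ N : ℕ in atTop, 1 ≤ Real.log N :=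
    (Real.tendsto_log_atTop.comp tendsto_natCast_atTop_atTop).eventually_ge_atTop 1
  have hεN : ∀ᶠ N : ℕ in atTop, 1 ≤ ε * (N : ℝ) :=
    (tendsto_natCast_atTop_atTop.const_mul_atTop hε).eventually_ge_atTop 1
  refine tendsto_of_tendsto_of_tendsto_of_le_of_le' hlow tendsto_const_nhds ?_
    (.of_forall fun N => prob_le_one)
  filter_upwards [hp, hlog1, hεN, eventually_ge_atTop 2,
    hlog (c := 1152 / ε) (by positivity)] with N h1 h2 h3 h4 h5
  have hcard : Fintype.card (Fin N) = N := Fintype.card_fin N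
  have hgood : ∀ G : SimpleGraph (Fin N), RandomWalk.HasTypicalCuts (p N) G →
      G.Connected ∧ ∀ i : Fin N,
        ENNReal.ofReal ((1 - ε) * N) ≤ RandomWalk.startingTime G i ∧
        RandomWalk.startingTime G i ≤ ENNReal.ofReal ((1 + ε) * N) := by
    intro G hG
    -- `1152 = 4 * 288` makes the relative error `L / δ = 288 / (p N / 4)` at most `ε`.
    have h6 : 1152 ≤ ε * (p N * N) := by
      have : 1152 / ε ≤ p N * N := le_trans (le_mul_of_one_le_right (by positivity) h2) h5
      rwa [div_le_iff₀ hε, mul_comm] at this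
    have := hG.startingTime (ε := ε) h1 (by rwa [hcard]) (by rwa [hcard]) (by rwa [hcard])
    simpa only [hcard] using this
  have h7 := RandomWalk.measure_not_hasTypicalCuts_le (V := Fin N) (p N) (by rwa [hcard]) rfl
  rw [hcard] at h7
  refine le_trans ?_ (measure_mono (show {G | RandomWalk.HasTypicalCuts (p N) G} ⊆ _ from hgood))
  have h8 : {G : SimpleGraph (Fin N) | RandomWalk.HasTypicalCuts (p N) G} =
      {G | ¬ RandomWalk.HasTypicalCuts (p N) G}ᶜ := by
    ext G
    simp
  rw [h8, prob_compl_eq_one_sub (Set.toFinite _).measurableSet]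
  exact tsub_le_tsub_left ((ENNReal.le_ofReal_iff_toReal_le (measure_ne_top _ _)
    (ENNReal.toReal_nonneg.trans h7)).2 h7) _
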